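/- Let $\mathcal A=\bigl(\prod_p\mathbb F_p\bigr)/\bigl(\bigoplus_p\mathbb F_p\bigr)$ and $\mathcal B=\bigl(\prod_p\mathbb F_p[T]\bigr)/\bigl(\bigoplus_p\mathbb F_p[T]\bigr)$, where $p$ runs over all primes; $\mathcal A$ is a $\mathbb Q$-algebra, and $\mathcal B$ is an $\mathcal A$-algebra via constant polynomials. An element of $\mathcal A$ or $\mathcal B$ is denoted by its $p$-component; in particular $T^p\in\mathcal B$ is the class of the family $(T^p)_p$. An index is a finite, possibly empty, sequence $\mathbf k=(k_1,\dots,k_r)$ of positive integers. For an index $\mathbf k$ define the finite multiple zeta value $$\zeta_{\mathcal A}(\mathbf k)=\sum_{\substack{l_1,\dots,l_r\ge 1\\ l_1+\cdots+l_r<p}}\frac1{l_1^{k_1}(l_1+l_2)^{k_2}\cdots(l_1+\cdots+l_r)^{k_r}}\in\mathcal A$$ and the finite multiple polylogarithm $$\mathrm{li}_{\mathbf k}(T)=\sideset{}{'}\sum_{0<l_1,\dots,l_r<p}\frac{T^{l_1+\cdots+l_r}}{l_1^{k_1}(l_1+l_2)^{k_2}\cdots(l_1+\cdots+l_r)^{k_r}}\in\mathcal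 B,$$ where $\sum'$ means that only the terms whose denominator is prime to $p$ are kept; for the empty index both are $1$. Let $\mathcal Z_{\mathcal A}\subset\mathcal A$ be the $\mathbb Q$-linear span of all $\zeta_{\mathcal A}(\mathbf k)$ (it is a $\mathbb Q$-subalgebra of $\mathcal A$ by the stuffle relation), and let $\mathcal Z_{\mathcal A}[T^p]\subset\mathcal B$ be the $\mathcal Z_{\mathcal A}$-subalgebra of $\mathcal B$ generated by $T^p$. Let $\mathcal R=\sum_{\mathbf k}\mathcal Z_{\mathcal A}[T^p]\,\mathrm{li}_{\mathbf k}(T)$ be the $\mathcal Z_{\mathcal A}[T^p]$-submodule of $\mathcal B$ spanned by the finite multiple polylogarithms $\mathrm{li}_{\mathbf k}(T)$ of all indices $\mathbf k$. Then $\mathcal R$ is closed under multiplication, and $\mathcal R$ is a $\mathcal Z_{\mathcal A}[T^p]$-subalgebra of $\mathcal B$. -/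

import Mathlib

noncomputable section

namespace FinitePolylog

/-- The direct sum of the rings `R p` over all primes `p`, as an ideal of their product:
the families with only finitely many nonzero components. -/
def almostZero (R : Nat.Primes → Type) [∀ p, CommRing (R p)] : Ideal (∀ p, R p) where
  carrier := {f | {p | f p ≠ 0}.Finite}
  zero_mem' := by simp
  add_mem' := by
    intro f g hf hg
    refine (hf.union hg).subset fun p hp => ?_
    by_contra h
    simp only [Set.mem_union, Set.mem_ofPred_eq, not_or, not_not] at h
    exact hp (by simp [h.1, h.2])
  smul_mem' := by
    intro c f hf
    refine hf.subset fun p hp h => hp ?_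
    simp [h]

/-- The ring `𝒜 = (∏ₚ 𝔽ₚ) / (⨁ₚ 𝔽ₚ)`. -/
abbrev A : Type := (∀ p : Nat.Primes, ZMod p) ⧸ almostZero fun p => ZMod p

/-- The ring `ℬ = (∏ₚ 𝔽ₚ[T]) / (⨁ₚ 𝔽ₚ[T])`. -/
abbrev B : Type :=
  (∀ p : Nat.Primes, Polynomial (ZMod p)) ⧸ almostZero fun p => Polynomial (ZMod p)

/-- The element of `𝒜` represented by a family. -/
def toA (f : ∀ p : Nat.Primes, ZMod p) : A := Ideal.Quotient.mk _ f

/-- The element of `ℬ` represented by a family. -/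
def toB (f : ∀ p : Nat.Primes, Polynomial (ZMod p)) : B := Ideal.Quotient.mk _ f

theorem isUnit_intCast_A (n : nonZeroDivisors ℤ) : IsUnit (Int.castRingHom A n) := by
  obtain ⟨n, hn⟩ := n
  have hn0 : n ≠ 0 := nonZeroDivisors.ne_zero hn
  refine IsUnit.of_mul_eq_one (toA fun p => (n : ZMod p)⁻¹) ?_
  have h1 : Int.castRingHom A n = toA fun p => (n : ZMod p) := by
    simp only [eq_intCast, toA]
    rw [← map_intCast (Ideal.Quotient.mk (almostZero fun p => ZMod p))]
    rfl
  change Int.castRingHom A n * _ = 1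
  rw [h1, toA, toA, ← map_mul, ← map_one (Ideal.Quotient.mk _), Ideal.Quotient.eq]
  have hfin : {p : Nat.Primes | (p : ℕ) ∣ n.natAbs}.Finite := by
    refine Set.Finite.of_finite_image (f := fun p : Nat.Primes => (p : ℕ)) ?_
      (fun a _ b _ h => Subtype.ext h)
    refine (Set.finite_Iic n.natAbs).subset ?_
    rintro _ ⟨p, hp, rfl⟩
    exact Nat.le_of_dvd (Int.natAbs_pos.mpr hn0) hp
  refine hfin.subset fun p hp => ?_
  by_contra h
  have : Fact (p : ℕ).Prime := ⟨p.2⟩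
  have hne : (n : ZMod p) ≠ 0 := by
    rw [Ne, ZMod.intCast_zmod_eq_zero_iff_dvd]
    intro h'
    exact h (Int.natCast_dvd.mp h')
  apply hp
  simp [mul_inv_cancel₀ hne]

/-- The (unique) `ℚ`-algebra structure of `𝒜`: every nonzero integer is invertible in `𝒜`. -/
instance : Algebra ℚ A :=
  (IsLocalization.lift (M := nonZeroDivisors ℤ) (S := ℚ) isUnit_intCast_A).toAlgebra

/-- The `𝒜`-algebra structure of `ℬ`: the class of `(aₚ)ₚ` acts as the class of the family of
constant polynomials `(aₚ)ₚ`. -/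
instance : Algebra A B :=
  (Ideal.Quotient.lift (almostZero fun p => ZMod p)
    ((Ideal.Quotient.mk (almostZero fun p => Polynomial (ZMod p))).comp
      (RingHom.pi fun p => Polynomial.C.comp (Pi.evalRingHom (fun p : Nat.Primes => ZMod p) p)))
    (by
      intro f hf
      refine Ideal.Quotient.eq_zero_iff_mem.mpr ?_
      refine Set.Finite.subset hf fun p hp h => hp ?_
      simp [h])).toAlgebra

theorem algebraMap_toA (f : ∀ p : Nat.Primes, ZMod p) :
    algebraMap A B (toA f) = toB fun p => Polynomial.C (f p) := rfl

/-- The `ℚ`-algebra structure of `ℬ`. -/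
instance : Algebra ℚ B := ((algebraMap A B).comp (algebraMap ℚ A)).toAlgebra

instance : IsScalarTower ℚ A B := IsScalarTower.of_algebraMap_eq fun _ => rfl

/-- An index `(k₁, …, kᵣ)`: a finite, possibly empty, sequence of positive integers. -/
abbrev Index : Type := Σ r : ℕ, Fin r → ℕ+

/-- The partial sum `l₁ + ⋯ + lᵢ`. -/
def partialSum {r : ℕ} (l : Fin r → ℕ) (i : Fin r) : ℕ := ∑ j ∈ Finset.Iic i, l j

/-- The product `l₁^k₁ (l₁ + l₂)^k₂ ⋯ (l₁ + ⋯ + lᵣ)^kᵣ`. -/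
def denom {r : ℕ} (k : Fin r → ℕ+) (l : Fin r → ℕ) : ℕ :=
  ∏ i, partialSum l i ^ (k i : ℕ)

/-- The sum of `1 / (l₁^k₁ (l₁ + l₂)^k₂ ⋯ (l₁ + ⋯ + lᵣ)^kᵣ)` in `ℤ/pℤ` over all positive integers
`l₁, …, lᵣ` with `l₁ + ⋯ + lᵣ < n`. -/
def zetaSum (p n : ℕ) {r : ℕ} (k : Fin r → ℕ+) : ZMod p :=
  ∑ l ∈ Fintype.piFinset (fun _ : Fin r => Finset.Ico 1 n) with ∑ i, l i < n,
    (denom k l : ZMod p)⁻¹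

/-- The finite multiple zeta value `ζ_𝒜(k)`. -/
def zetaA (k : Index) : A := toA fun p => zetaSum p p k.2

/-- The `p`-component of the finite multiple polylogarithm: the sum of
`T^(l₁ + ⋯ + lᵣ) / (l₁^k₁ (l₁ + l₂)^k₂ ⋯ (l₁ + ⋯ + lᵣ)^kᵣ)` over `0 < l₁, …, lᵣ < p`, restricted
to the terms whose denominator is prime to `p`. -/
def liSum (p : ℕ) {r : ℕ} (k : Fin r → ℕ+) : Polynomial (ZMod p) :=
  ∑ l ∈ Fintype.piFinset (fun _ : Fin r => Finset.Ioo 0 p) with (denom k l).Coprime p,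
    Polynomial.C (denom k l : ZMod p)⁻¹ * Polynomial.X ^ (∑ i, l i)

/-- The finite multiple polylogarithm `li_k(T)`. -/
def li (k : Index) : B := toB fun p => liSum p k.2

/-- The element `T^p` of `ℬ`. -/
def Tp : B := toB fun p => Polynomial.X ^ (p : ℕ)

/-- The same sum as `zetaSum`, by recursion on the reversed index: `zetaList p (kᵣ, …, k₁) n` is the
sum of `1 / (m₁^k₁ ⋯ mᵣ^kᵣ)` over `0 < m₁ < ⋯ < mᵣ ≤ n`. -/
def zetaList (p : ℕ) : List ℕ+ → ℕ → ZMod p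
  | [], _ => 1
  | a :: k, n => ∑ m ∈ Finset.range n, (((m + 1 : ℕ) : ZMod p) ^ (a : ℕ))⁻¹ * zetaList p k m

theorem partialSum_snoc_castSucc {r : ℕ} (l : Fin r → ℕ) (a : ℕ) (i : Fin r) :
    partialSum (Fin.snoc l a : Fin (r + 1) → ℕ) i.castSucc = partialSum l i := by
  have h : ∀ (s : ℕ) (g : Fin s → ℕ) (j : Fin s),
      partialSum g j = ∑ x, if x ≤ j then g x else 0 := by
    intro s g j
    rw [partialSum, ← Finset.sum_filter]
    congr 1
    ext x
    simp
  rw [h, h, Fin.sum_univ_castSucc]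
  simp [not_le.mpr (Fin.castSucc_lt_last i)]

theorem partialSum_last {r : ℕ} (l : Fin (r + 1) → ℕ) :
    partialSum l (Fin.last r) = ∑ i, l i := by
  rw [partialSum]
  congr 1
  ext x
  simp [Fin.le_last]

theorem zetaSum_succ (p : ℕ) [Fact p.Prime] (n : ℕ) {r : ℕ} (k : Fin (r + 1) → ℕ+) :
    zetaSum p (n + 1) k = ∑ m ∈ Finset.range n,
      (((m + 1 : ℕ) : ZMod p) ^ (k (Fin.last r) : ℕ))⁻¹ *
        zetaSum p (m + 1) (fun i => k i.castSucc) := by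
  simp only [zetaSum, Finset.mul_sum]
  rw [Finset.sum_sigma']
  symm
  refine Finset.sum_bij'
    (fun x _ => (Fin.snoc x.2 (x.1 + 1 - ∑ i, x.2 i) : Fin (r + 1) → ℕ))
    (fun l _ => ⟨∑ i, l i - 1, fun i => l i.castSucc⟩) ?_ ?_ ?_ ?_ ?_
  · rintro ⟨m, l⟩ h
    simp only [Finset.mem_sigma, Finset.mem_range, Finset.mem_filter, Fintype.mem_piFinset,
      Finset.mem_Ico] at h ⊢
    obtain ⟨hm, hl, hs⟩ := h
    constructor
    · intro i
      refine Fin.lastCases ?_ (fun j => ?_) i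
      · simp only [Fin.snoc_last]; omega
      · simp only [Fin.snoc_castSucc]
        have := hl j
        omega
    · rw [Fin.sum_univ_castSucc]
      simp only [Fin.snoc_last, Fin.snoc_castSucc]
      omega
  · intro l h
    simp only [Finset.mem_sigma, Finset.mem_range, Finset.mem_filter, Fintype.mem_piFinset,
      Finset.mem_Ico] at h ⊢
    obtain ⟨hl, hs⟩ := h
    rw [Fin.sum_univ_castSucc] at hs ⊢
    have h1 := hl (Fin.last r)
    refine ⟨by omega, fun i => ?_, by omega⟩
    have h2 := hl i.castSucc
    have h3 : l i.castSucc ≤ ∑ j : Fin r, l j.castSucc :=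
      Finset.single_le_sum (f := fun j : Fin r => l j.castSucc) (fun _ _ => Nat.zero_le _)
        (Finset.mem_univ i)
    omega
  · rintro ⟨m, l⟩ h
    simp only [Finset.mem_sigma, Finset.mem_range, Finset.mem_filter, Fintype.mem_piFinset,
      Finset.mem_Ico] at h
    obtain ⟨hm, hl, hs⟩ := h
    simp only [Fin.sum_univ_castSucc, Fin.snoc_last, Fin.snoc_castSucc]
    congr 1
    omega
  · intro l h
    simp only [Finset.mem_filter, Fintype.mem_piFinset, Finset.mem_Ico] at h
    have h1 := h.1 (Fin.last r)
    funext i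
    refine Fin.lastCases ?_ (fun j => ?_) i
    · simp only [Fin.snoc_last, Fin.sum_univ_castSucc]
      omega
    · simp only [Fin.snoc_castSucc]
  · rintro ⟨m, l⟩ h
    simp only [Finset.mem_sigma, Finset.mem_range, Finset.mem_filter, Fintype.mem_piFinset,
      Finset.mem_Ico] at h
    obtain ⟨hm, hl, hs⟩ := h
    have hlast : partialSum (Fin.snoc l (m + 1 - ∑ i, l i) : Fin (r + 1) → ℕ) (Fin.last r)
        = m + 1 := by
      rw [partialSum_last, Fin.sum_univ_castSucc]
      simp only [Fin.snoc_last, Fin.snoc_castSucc]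
      omega
    simp only [denom]
    rw [Fin.prod_univ_castSucc, hlast]
    simp only [partialSum_snoc_castSucc]
    push_cast
    rw [mul_inv, mul_comm]

theorem zetaSum_eq_zetaList (p : ℕ) [Fact p.Prime] {r : ℕ} (k : Fin r → ℕ+) (n : ℕ) :
    zetaSum p (n + 1) k = zetaList p (List.ofFn k).reverse n := by
  induction r generalizing n with
  | zero => simp [zetaSum, zetaList, denom]
  | succ r ih =>
    rw [zetaSum_succ, List.ofFn_succ_last, List.reverse_append, List.reverse_singleton,
      List.singleton_append, zetaList]
    exact Finset.sum_congr rfl fun m _ => by rw [ih]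

theorem zetaList_cons_succ (p : ℕ) (a : ℕ+) (k : List ℕ+) (n : ℕ) :
    zetaList p (a :: k) (n + 1) =
      zetaList p (a :: k) n + (((n + 1 : ℕ) : ZMod p) ^ (a : ℕ))⁻¹ * zetaList p k n := by
  simp only [zetaList, Finset.sum_range_succ]

theorem sum_map_zetaList_cons_succ (p : ℕ) (a : ℕ+) (s : List (List ℕ+)) (n : ℕ) :
    ((s.map (a :: ·)).map fun k => zetaList p k (n + 1)).sum =
      ((s.map (a :: ·)).map fun k => zetaList p k n).sum +
        (((n + 1 : ℕ) : ZMod p) ^ (a : ℕ))⁻¹ * (s.map fun k => zetaList p k n).sum := by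
  induction s with
  | nil => simp
  | cons k s ih =>
    simp only [List.map_cons, List.sum_cons, ih, zetaList_cons_succ]
    ring

theorem sum_map_zetaList_cons_zero (p : ℕ) (a : ℕ+) (s : List (List ℕ+)) :
    ((s.map (a :: ·)).map fun k => zetaList p k 0).sum = 0 := by
  induction s with
  | nil => simp
  | cons k s ih => simp only [List.map_cons, List.sum_cons, ih, zetaList]; simp

/-- The stuffle relation: a product of two of the sums is a sum of such sums. -/
theorem zetaList_mul (k k' : List ℕ+) :
    ∃ s : List (List ℕ+), ∀ p : ℕ, p.Prime → ∀ n : ℕ,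
      zetaList p k n * zetaList p k' n = (s.map fun j => zetaList p j n).sum := by
  induction k generalizing k' with
  | nil => exact ⟨[k'], fun p _ n => by simp [zetaList]⟩
  | cons a k ih =>
    induction k' with
    | nil => exact ⟨[a :: k], fun p _ n => by simp [zetaList]⟩
    | cons b k' ih' =>
      obtain ⟨s₁, h₁⟩ := ih (b :: k')
      obtain ⟨s₂, h₂⟩ := ih'
      obtain ⟨s₃, h₃⟩ := ih k'
      refine ⟨s₁.map (a :: ·) ++ s₂.map (b :: ·) ++ s₃.map ((a + b) :: ·), fun p hp n => ?_⟩
      have : Fact p.Prime := ⟨hp⟩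
      induction n with
      | zero =>
        simp only [List.map_append, List.sum_append, sum_map_zetaList_cons_zero]
        simp [zetaList]
      | succ n ihn =>
        simp only [List.map_append, List.sum_append, sum_map_zetaList_cons_succ] at ihn ⊢
        rw [← h₁ p hp n, ← h₂ p hp n, ← h₃ p hp n, zetaList_cons_succ, zetaList_cons_succ,
          PNat.add_coe, pow_add, mul_inv]
        linear_combination ihn

theorem toA_list_sum (s : List (∀ p : Nat.Primes, ZMod p)) :
    toA s.sum = (s.map toA).sum := map_list_sum (Ideal.Quotient.mk _) s

theorem zetaA_mul_mem (k k' : Index) :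
    zetaA k * zetaA k' ∈ Submodule.span ℚ (Set.range zetaA) := by
  obtain ⟨s, hs⟩ := zetaList_mul (List.ofFn k.2).reverse (List.ofFn k'.2).reverse
  have hz : ∀ (j : Index) (p : Nat.Primes),
      zetaSum p p j.2 = zetaList p (List.ofFn j.2).reverse (p - 1) := by
    intro j p
    have : Fact (p : ℕ).Prime := ⟨p.2⟩
    rw [← zetaSum_eq_zetaList, Nat.sub_add_cancel p.2.one_le]
  let e : List ℕ+ → Index := fun j => ⟨j.reverse.length, j.reverse.get⟩
  have he : ∀ j, (List.ofFn (e j).2).reverse = j := by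
    intro j
    simp only [e, List.ofFn_get, List.reverse_reverse]
  have key : zetaA k * zetaA k' = ((s.map e).map zetaA).sum := by
    have h1 : zetaA k * zetaA k' =
        toA ((s.map fun j => fun p : Nat.Primes => zetaSum p p (e j).2).sum) := by
      rw [zetaA, zetaA, toA, toA, ← map_mul, toA]
      congr 1
      funext p
      rw [Pi.mul_apply, hz, hz, hs p p.2, Pi.list_sum_apply]
      simp only [List.map_map]
      congr 1
      refine List.map_congr_left fun j _ => ?_
      simp only [Function.comp_apply]
      rw [hz, he]
    rw [h1, toA_list_sum]
    simp only [List.map_map]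
    rfl
  rw [key]
  refine list_sum_mem fun x hx => ?_
  obtain ⟨j, -, rfl⟩ := List.mem_map.mp hx
  exact Submodule.subset_span ⟨j, rfl⟩

theorem one_mem_span_zetaA : (1 : A) ∈ Submodule.span ℚ (Set.range zetaA) := by
  refine Submodule.subset_span ⟨⟨0, Fin.elim0⟩, ?_⟩
  rw [zetaA, toA, ← map_one (Ideal.Quotient.mk _)]
  congr 1
  funext p
  simp [zetaSum, denom, p.2.pos]

/-- `𝒵_𝒜`: the `ℚ`-linear span of all finite multiple zeta values, which is a `ℚ`-subalgebra of `𝒜`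
by the stuffle relation. -/
def ZA : Subalgebra ℚ A :=
  (Submodule.span ℚ (Set.range zetaA)).toSubalgebra one_mem_span_zetaA (by
    intro x y hx hy
    have h : Submodule.span ℚ (Set.range zetaA) * Submodule.span ℚ (Set.range zetaA) ≤
        Submodule.span ℚ (Set.range zetaA) := by
      rw [Submodule.span_mul_span, Submodule.span_le]
      rintro _ ⟨_, ⟨k, rfl⟩, _, ⟨k', rfl⟩, rfl⟩
      exact zetaA_mul_mem k k'
    exact h (Submodule.mul_mem_mul hx hy))

/-- `𝒵_𝒜[T^p]`: the subring of `ℬ` generated by `T^p` over `𝒵_𝒜`. -/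
abbrev ZATp : Subalgebra ZA B := Algebra.adjoin ZA {Tp}

/-- `ℛ = ∑_k 𝒵_𝒜[T^p] li_k(T)`: the `𝒵_𝒜[T^p]`-submodule of `ℬ` spanned by the finite multiple
polylogarithms. -/
def R : Submodule ZATp B := Submodule.span ZATp (Set.range li)

end FinitePolylog

end

noncomputable section

namespace FinitePolylog

open Polynomial

/-! Let D = T d/dT. In `𝔽_p` the denominators depend only on the partial sums mod p, and T^(s+p) =
T^p T^s. Hence each polylogarithm equals ∑_{n<p} c(n) T^n, where c(n) is n^(-k_r) times the sum of
the inner coefficients below n plus T^p times their sum above n (`sum_inv_denom_mul`). So D lowers a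
last exponent k_r > 1 by one. For k_r = 1 it gives T + ⋯ + T^(p-1) times the polylogarithm without
k_r, minus a defect in the ring generated by T^p and the multiple harmonic sums
(`geomFamily_mul_polyFamily`).

Products fg of polylogarithms are treated by induction on the total weight. By the Leibniz rule,
D(fg) reduces to products of smaller weight, possibly times the geometric polynomial, and these can
be integrated up to a coefficient (`euler_polyFamily_mul_mem`). The kernel of D consists of the
polynomials in T^p, so it remains to find the projection of fg to them. This is T^p ∑ c(m) c'(p-m),
and the reflection m ↦ p-m together with the stuffle relation shows that it is a coefficient
(`proj_polyFamily_mul_mem`).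

The argument works for all primes at once with integral coefficients; the quotient enters only at
the end. -/

instance factPrime (p : Nat.Primes) : Fact (p : ℕ).Prime := ⟨p.2⟩

/-! ### Coefficient ring and sequences of multiple harmonic sums -/

/-- The product of the polynomial rings `𝔽_p[T]` over all primes `p`. -/
abbrev PolyFamily : Type := ∀ p : Nat.Primes, (ZMod p)[X]

/-- The family `(T^p)_p`. -/
def powFamily : PolyFamily := fun p => X ^ (p : ℕ)

/-- The family of constant polynomials given by a multiple harmonic sum of length `p - 1`. -/
def zetaFamily (k : List ℕ+) : PolyFamily := fun p => C (zetaList p k (p - 1))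

/-- The ring of families generated by `(T^p)_p` and the multiple harmonic sums. -/
def coeffRing : Subring PolyFamily :=
  Subring.closure (insert powFamily (Set.range zetaFamily))

theorem powFamily_mem : powFamily ∈ coeffRing :=
  Subring.subset_closure (Set.mem_insert _ _)

theorem zetaFamily_mem (k : List ℕ+) : zetaFamily k ∈ coeffRing :=
  Subring.subset_closure (Set.mem_insert_of_mem _ ⟨k, rfl⟩)

/-- The sequence with terms `n^(-a)` times the multiple harmonic sum of length `n - 1`. -/
def basicSeq (a : ℕ) (k : List ℕ+) : ℕ → PolyFamily :=
  fun n p => C ((n : ZMod p)⁻¹ ^ a * zetaList p k (n - 1))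

/-- The span of the sequences `basicSeq a k` over `coeffRing`. -/
def sumSpace : Submodule coeffRing (ℕ → PolyFamily) :=
  Submodule.span coeffRing (Set.range fun x : ℕ × List ℕ+ => basicSeq x.1 x.2)

theorem basicSeq_mem (a : ℕ) (k : List ℕ+) : basicSeq a k ∈ sumSpace :=
  Submodule.subset_span ⟨(a, k), rfl⟩

theorem smul_seq_apply (z : coeffRing) (f : ℕ → PolyFamily) (n : ℕ) (p : Nat.Primes) :
    (z • f) n p = (z : PolyFamily) p * f n p := rfl

theorem seq_list_sum_apply (s : List (ℕ → PolyFamily)) (n : ℕ) (p : Nat.Primes) :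
    s.sum n p = (s.map fun f => f n p).sum := by
  induction s with
  | nil => rfl
  | cons f s ih => rw [List.sum_cons, List.map_cons, List.sum_cons, ← ih]; rfl

/-- The list of indices given by the stuffle relation depends neither on the length n nor on p, so
it yields one identity between sequences of families. -/
theorem basicSeq_mul (a b : ℕ) (k l : List ℕ+) : basicSeq a k * basicSeq b l ∈ sumSpace := by
  obtain ⟨s, hs⟩ := zetaList_mul k l
  have h : basicSeq a k * basicSeq b l = (s.map (basicSeq (a + b))).sum := by
    funext n p
    rw [seq_list_sum_apply]
    simp only [List.map_map, Function.comp_def, basicSeq, Pi.mul_apply]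
    rw [← C_mul, pow_add, mul_mul_mul_comm, hs p p.2, C_mul, map_list_sum, List.map_map,
      ← List.sum_map_mul_left]
    simp [C_mul]
  rw [h]
  refine list_sum_mem fun x hx => ?_
  obtain ⟨j, -, rfl⟩ := List.mem_map.mp hx
  exact basicSeq_mem _ _

theorem sumSpace_mul {f g : ℕ → PolyFamily} (hf : f ∈ sumSpace) (hg : g ∈ sumSpace) :
    f * g ∈ sumSpace := by
  have h : sumSpace * sumSpace ≤ sumSpace := by
    conv_lhs => rw [sumSpace]
    rw [Submodule.span_mul_span, Submodule.span_le]
    rintro _ ⟨_, ⟨⟨a, k⟩, rfl⟩, _, ⟨⟨b, l⟩, rfl⟩, rfl⟩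
    exact basicSeq_mul a b k l
  exact h (Submodule.mul_mem_mul hf hg)

theorem const_mem_sumSpace {z : PolyFamily} (hz : z ∈ coeffRing) :
    (fun _ => z : ℕ → PolyFamily) ∈ sumSpace := by
  have h : (fun _ => z : ℕ → PolyFamily) = (⟨z, hz⟩ : coeffRing) • basicSeq 0 [] := by
    funext n p
    simp [smul_seq_apply, basicSeq, zetaList]
  rw [h]
  exact Submodule.smul_mem _ _ (basicSeq_mem _ _)

/-! ### Summation operators -/

/-- The sequence of the sums of `f m / m` over `0 < m < n`. -/
def sumBelow : (ℕ → PolyFamily) →ₗ[coeffRing] (ℕ → PolyFamily) where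
  toFun f n p := ∑ m ∈ Finset.range n, C ((m : ZMod p)⁻¹) * f m p
  map_add' f g := by
    funext n p
    simp only [Pi.add_apply, mul_add, Finset.sum_add_distrib]
  map_smul' z f := by
    funext n p
    simp only [smul_seq_apply, RingHom.id_apply, Finset.mul_sum]
    exact Finset.sum_congr rfl fun m _ => mul_left_comm _ _ _

theorem sumBelow_apply (f : ℕ → PolyFamily) (n : ℕ) (p : Nat.Primes) :
    sumBelow f n p = ∑ m ∈ Finset.range n, C ((m : ZMod p)⁻¹) * f m p := rfl

/-- The sum of `f m / m` over `0 < m < p`. -/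
def sumAll : (ℕ → PolyFamily) →ₗ[coeffRing] PolyFamily where
  toFun f p := sumBelow f p p
  map_add' f g := by
    rw [map_add]; rfl
  map_smul' z f := by
    rw [map_smul]; rfl

theorem sumAll_apply (f : ℕ → PolyFamily) (p : Nat.Primes) :
    sumAll f p = ∑ m ∈ Finset.range p, C ((m : ZMod p)⁻¹) * f m p := rfl

/-- The weight 1/m in the summation raises the exponent to a + 1 ≥ 1, which is what makes the result
a multiple harmonic sum even for a = 0. The term m = 0 vanishes because 0⁻¹ = 0. -/
theorem sumBelow_basicSeq (a : ℕ) (k : List ℕ+) :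
    sumBelow (basicSeq a k) = basicSeq 0 (a.succPNat :: k) := by
  funext n p
  rw [sumBelow_apply]
  cases n with
  | zero => simp [basicSeq, zetaList]
  | succ n =>
    rw [Finset.sum_range_succ']
    simp only [basicSeq, zetaList, Nat.add_sub_cancel, ← C_mul, ← map_sum]
    simp only [Nat.cast_zero, inv_zero, zero_mul, map_zero, add_zero, pow_zero, one_mul]
    congr 1
    refine Finset.sum_congr rfl fun m _ => ?_
    rw [Nat.succPNat_coe, ← inv_pow, Nat.succ_eq_add_one, pow_succ']
    ring

theorem sumBelow_mem {f : ℕ → PolyFamily} (hf : f ∈ sumSpace) : sumBelow f ∈ sumSpace := by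
  have h : sumSpace ≤ sumSpace.comap sumBelow := by
    conv_lhs => rw [sumSpace]
    rw [Submodule.span_le]
    rintro _ ⟨⟨a, k⟩, rfl⟩
    change sumBelow (basicSeq a k) ∈ sumSpace
    rw [sumBelow_basicSeq]
    exact basicSeq_mem _ _
  exact h hf

theorem sumAll_mem {f : ℕ → PolyFamily} (hf : f ∈ sumSpace) : sumAll f ∈ coeffRing := by
  induction hf using Submodule.span_induction with
  | mem f hf =>
    obtain ⟨⟨a, k⟩, rfl⟩ := hf
    have h : sumAll (basicSeq a k) = zetaFamily (a.succPNat :: k) := by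
      funext p
      change sumBelow (basicSeq a k) p p = _
      rw [sumBelow_basicSeq]
      simp [basicSeq, zetaFamily]
    exact h ▸ zetaFamily_mem _
  | zero => rw [map_zero]; exact zero_mem _
  | add f g _ _ hf hg => rw [map_add]; exact add_mem hf hg
  | smul z f _ hf => rw [map_smul]; exact mul_mem z.2 hf

/-- The sums of `f m / m` over `n < m < p` for `n < p`. -/
def sumAbove (f : ℕ → PolyFamily) : ℕ → PolyFamily :=
  (fun _ => sumAll f) - sumBelow f - basicSeq 1 [] * f

theorem sumAbove_mem {f : ℕ → PolyFamily} (hf : f ∈ sumSpace) : sumAbove f ∈ sumSpace :=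
  sub_mem (sub_mem (const_mem_sumSpace (sumAll_mem hf)) (sumBelow_mem hf))
    (sumSpace_mul (basicSeq_mem _ _) hf)

theorem sum_range_eq_add_Ioo {M : Type*} [AddCommMonoid M] (g : ℕ → M) {n p : ℕ} (h : n < p) :
    ∑ m ∈ Finset.range p, g m =
      ∑ m ∈ Finset.range n, g m + g n + ∑ m ∈ Finset.Ioo n p, g m := by
  rw [← Finset.sum_range_succ, ← Finset.sum_range_add_sum_Ico g (Nat.succ_le_of_lt h)]
  rfl

theorem sumAbove_apply (f : ℕ → PolyFamily) {n : ℕ} {p : Nat.Primes} (h : n < p) :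
    sumAbove f n p = ∑ m ∈ Finset.Ioo n (p : ℕ), C ((m : ZMod p)⁻¹) * f m p := by
  have h1 : sumAbove f n p =
      sumAll f p - sumBelow f n p - C ((n : ZMod p)⁻¹) * f n p := by
    simp [sumAbove, basicSeq, zetaList]
  rw [h1, sumAll_apply, sumBelow_apply, sum_range_eq_add_Ioo _ h]
  ring

/-! ### Reflection of harmonic sums -/

/-- `g n = f (p - n)` for all `n < p`. -/
def IsReflection (f g : ℕ → PolyFamily) : Prop :=
  ∀ p : Nat.Primes, ∀ n < (p : ℕ), g n p = f (p - n) p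

theorem cast_sub_prime {p : Nat.Primes} {n : ℕ} (h : n ≤ p) :
    ((p - n : ℕ) : ZMod p) = -(n : ZMod p) := by
  rw [Nat.cast_sub h]; simp

/-- The substitution m ↦ p - m exchanges sums below p - n and sums above n; the sign comes from 1/(p
- m) = -1/m in `𝔽_p`. -/
theorem sumBelow_reflection {f g : ℕ → PolyFamily} (h : IsReflection f g) :
    IsReflection (sumBelow f) (-sumAbove g) := by
  intro p n hn
  rw [Pi.neg_apply, Pi.neg_apply, sumAbove_apply _ hn, sumBelow_apply, ← Finset.sum_neg_distrib]
  -- The term at 0 is split off: it vanishes, and its mirror image p lies outside the open interval.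
  rw [Finset.range_eq_Ico, Finset.sum_eq_sum_Ico_succ_bot (by omega)]
  simp only [Nat.cast_zero, inv_zero, map_zero, zero_mul, zero_add]
  refine Finset.sum_bij' (fun m _ => p - m) (fun m _ => p - m) ?_ ?_ ?_ ?_ ?_
  · intro m hm
    simp only [Finset.mem_Ioo, Finset.mem_Ico] at hm ⊢
    omega
  · intro m hm
    simp only [Finset.mem_Ioo, Finset.mem_Ico] at hm ⊢
    omega
  · intro m hm
    simp only [Finset.mem_Ioo] at hm
    omega
  · intro m hm
    simp only [Finset.mem_Ico] at hm
    omega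
  · intro m hm
    simp only [Finset.mem_Ioo] at hm
    rw [cast_sub_prime hm.2.le, h p m hm.2, inv_neg, C_neg, neg_mul]

theorem basicSeq_one_reflection : IsReflection (basicSeq 1 []) (-basicSeq 1 []) := by
  intro p n hn
  simp [basicSeq, zetaList, Nat.cast_sub hn.le, inv_neg]

theorem IsReflection.mul {f g f' g' : ℕ → PolyFamily} (h : IsReflection f g)
    (h' : IsReflection f' g') : IsReflection (f * f') (g * g') := by
  intro p n hn
  simp only [Pi.mul_apply, h p n hn, h' p n hn]

theorem basicSeq_succ (a : ℕ) (k : List ℕ+) :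
    basicSeq (a + 1) k = basicSeq 1 [] * basicSeq a k := by
  funext n p
  simp only [basicSeq, Pi.mul_apply, ← C_mul, zetaList]
  congr 1
  ring

/-- Every basic sequence arises from the constant 1 by multiplication with 1/n, which reflects to
-1/n, and by `sumBelow`, which reflects to `-sumAbove`. -/
theorem exists_reflection_basicSeq (a : ℕ) (k : List ℕ+) :
    ∃ g ∈ sumSpace, IsReflection (basicSeq a k) g := by
  induction k generalizing a with
  | nil =>
    induction a with
    | zero => exact ⟨_, basicSeq_mem 0 [], fun p n _ => by simp [basicSeq, zetaList]⟩
    | succ a ih =>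
      obtain ⟨g, hg, h⟩ := ih
      rw [basicSeq_succ]
      exact ⟨_, sumSpace_mul (neg_mem (basicSeq_mem _ _)) hg, basicSeq_one_reflection.mul h⟩
  | cons b k ih =>
    induction a with
    | zero =>
      obtain ⟨g, hg, h⟩ := ih b.natPred
      rw [← PNat.succPNat_natPred b, ← sumBelow_basicSeq]
      exact ⟨_, neg_mem (sumAbove_mem hg), sumBelow_reflection h⟩
    | succ a ih' =>
      obtain ⟨g, hg, h⟩ := ih'
      rw [basicSeq_succ]
      exact ⟨_, sumSpace_mul (neg_mem (basicSeq_mem _ _)) hg, basicSeq_one_reflection.mul h⟩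

theorem exists_reflection {f : ℕ → PolyFamily} (hf : f ∈ sumSpace) :
    ∃ g ∈ sumSpace, IsReflection f g := by
  induction hf using Submodule.span_induction with
  | mem f hf =>
    obtain ⟨⟨a, k⟩, rfl⟩ := hf
    exact exists_reflection_basicSeq a k
  | zero => exact ⟨0, zero_mem _, fun _ _ _ => rfl⟩
  | add f g _ _ hf hg =>
    obtain ⟨f', hf', h⟩ := hf
    obtain ⟨g', hg', h'⟩ := hg
    exact ⟨f' + g', add_mem hf' hg', fun p n hn => by
      simp only [Pi.add_apply, h p n hn, h' p n hn]⟩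
  | smul z f _ hf =>
    obtain ⟨f', hf', h⟩ := hf
    exact ⟨z • f', Submodule.smul_mem _ _ hf', fun p n hn => by
      simp only [smul_seq_apply, h p n hn]⟩

/-! ### Expansion of the polylogarithms in powers of T below p -/

/-- The coefficients of the finite multiple polylogarithm of a reversed index with respect to
`1, T, …, T^(p-1)`, which are polynomials in `T^p`. -/
def polyCoeff (p : ℕ) : List ℕ+ → ℕ → (ZMod p)[X]
  | [], n => if n = 0 then 1 else 0
  | a :: k, n => C ((n : ZMod p)⁻¹ ^ (a : ℕ)) *
      (∑ m ∈ Finset.range n, polyCoeff p k m + X ^ p * ∑ m ∈ Finset.Ioo n p, polyCoeff p k m)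

/-- The finite multiple polylogarithms of a reversed index, for all primes. -/
def polyFamily (k : List ℕ+) : PolyFamily :=
  fun p => ∑ n ∈ Finset.range p, polyCoeff p k n * X ^ n

theorem polyCoeff_cons_zero (p : Nat.Primes) (a : ℕ+) (k : List ℕ+) :
    polyCoeff p (a :: k) 0 = 0 := by
  simp [polyCoeff]

/-- With n = m + b, the inner index runs over m < n < m + p. The part from p on wraps around to 0 ≤
n < m at the cost of a factor T^p; interchanging the two sums gives the right side. -/
theorem sum_mul_sum_Ioo_shift (p : ℕ) (f φ : ℕ → (ZMod p)[X])
    (hφ : ∀ s, φ (s + p) = X ^ p * φ s) :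
    ∑ m ∈ Finset.range p, f m * ∑ b ∈ Finset.Ioo 0 p, φ (m + b) =
      ∑ n ∈ Finset.range p, φ n *
        (∑ m ∈ Finset.range n, f m + X ^ p * ∑ m ∈ Finset.Ioo n p, f m) := by
  have h1 : ∀ m ∈ Finset.range p, f m * ∑ b ∈ Finset.Ioo 0 p, φ (m + b) =
      ∑ n ∈ Finset.range p, if m < n then φ n * f m else
        if n < m then φ n * (X ^ p * f m) else 0 := by
    intro m hm
    rw [Finset.mem_range] at hm
    have h2 : ∑ b ∈ Finset.Ioo 0 p, φ (m + b) = ∑ n ∈ Finset.Ioo m (m + p), φ n := by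
      have h4 := Finset.map_add_left_Ioo 0 p m
      rw [add_zero] at h4
      rw [← h4, Finset.sum_map]
      rfl
    have h3 : ∑ n ∈ Finset.Ioo m (m + p), φ n =
        ∑ n ∈ Finset.Ioo m p, φ n + ∑ n ∈ Finset.range m, X ^ p * φ n := by
      have h4 : ∑ n ∈ Finset.range m, X ^ p * φ n = ∑ n ∈ Finset.Ico p (m + p), φ n := by
        have h5 := Finset.sum_Ico_add' φ 0 m p
        rw [zero_add] at h5
        rw [Finset.range_eq_Ico, ← h5]
        exact Finset.sum_congr rfl fun n _ => (hφ n).symm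
      rw [h4]
      exact (Finset.sum_Ico_consecutive φ (Nat.succ_le_of_lt hm) (Nat.le_add_left p m)).symm
    rw [sum_range_eq_add_Ioo _ hm, h2, h3, mul_add, Finset.mul_sum, Finset.mul_sum, add_comm]
    simp only [lt_irrefl, if_false, add_zero]
    congr 1
    · refine Finset.sum_congr rfl fun n hn => ?_
      rw [Finset.mem_range] at hn
      rw [if_neg hn.le.not_gt, if_pos hn]
      ring
    · refine Finset.sum_congr rfl fun n hn => ?_
      rw [Finset.mem_Ioo] at hn
      rw [if_pos hn.1, mul_comm]
  rw [Finset.sum_congr rfl h1, Finset.sum_comm]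
  refine Finset.sum_congr rfl fun n hn => ?_
  rw [Finset.mem_range] at hn
  rw [sum_range_eq_add_Ioo _ hn, mul_add, Finset.mul_sum, Finset.mul_sum, Finset.mul_sum]
  simp only [lt_irrefl, if_false, add_zero]
  congr 1
  · refine Finset.sum_congr rfl fun m hm => ?_
    rw [if_pos (Finset.mem_range.mp hm)]
  · refine Finset.sum_congr rfl fun m hm => ?_
    rw [Finset.mem_Ioo] at hm
    rw [if_neg hm.1.le.not_gt, if_pos hm.1]

/-- The restriction to denominators prime to p is automatic, since 0⁻¹ = 0 in `ZMod p`. -/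
theorem liSum_eq_sum_piFinset (p : Nat.Primes) {r : ℕ} (k : Fin r → ℕ+) :
    liSum p k = ∑ l ∈ Fintype.piFinset (fun _ : Fin r => Finset.Ioo 0 (p : ℕ)),
      C (denom k l : ZMod p)⁻¹ * X ^ (∑ i, l i) := by
  rw [liSum, Finset.sum_filter]
  refine Finset.sum_congr rfl fun l _ => ?_
  split_ifs with h
  · rfl
  · have h0 : (denom k l : ZMod p) = 0 := by
      rw [ZMod.natCast_eq_zero_iff]
      rwa [Nat.coprime_comm, p.2.coprime_iff_not_dvd, not_not] at h
    rw [h0, inv_zero, C_0, zero_mul]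

theorem denom_snoc {r : ℕ} (k : Fin (r + 1) → ℕ+) (l : Fin r → ℕ) (b : ℕ) :
    denom k (Fin.snoc l b : Fin (r + 1) → ℕ) =
      denom (fun i => k i.castSucc) l * (∑ i, l i + b) ^ (k (Fin.last r) : ℕ) := by
  rw [denom, Fin.prod_univ_castSucc, partialSum_last, Fin.sum_univ_castSucc]
  simp only [partialSum_snoc_castSucc, Fin.snoc_castSucc, Fin.snoc_last, denom]

theorem sum_piFinset_snoc {M : Type*} [AddCommMonoid M] {r : ℕ} (s : Finset ℕ)
    (F : (Fin (r + 1) → ℕ) → M) :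
    ∑ l ∈ Fintype.piFinset (fun _ : Fin (r + 1) => s), F l =
      ∑ l ∈ Fintype.piFinset (fun _ : Fin r => s), ∑ b ∈ s,
        F (Fin.snoc l b : Fin (r + 1) → ℕ) := by
  rw [Finset.sum_sigma']
  refine Finset.sum_bij' (fun l _ => ⟨fun i => l i.castSucc, l (Fin.last r)⟩)
    (fun x _ => (Fin.snoc x.1 x.2 : Fin (r + 1) → ℕ)) ?_ ?_ ?_ ?_ ?_
  · intro l hl
    simp only [Fintype.mem_piFinset, Finset.mem_sigma] at hl ⊢
    exact ⟨fun i => hl _, hl _⟩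
  · rintro ⟨l, b⟩ h
    simp only [Fintype.mem_piFinset, Finset.mem_sigma] at h ⊢
    intro i
    refine Fin.lastCases ?_ (fun j => ?_) i
    · simpa using h.2
    · simpa using h.1 j
  · intro l _
    funext i
    refine Fin.lastCases ?_ (fun j => ?_) i <;> simp
  · rintro ⟨l, b⟩ _
    simp
  · intro l _
    congr 1
    funext i
    refine Fin.lastCases ?_ (fun j => ?_) i <;> simp

/-- An arbitrary test function φ in place of T^s makes the induction on the depth possible: the last
variable is summed into a new test function, which satisfies the same shift rule. -/
theorem sum_inv_denom_mul (p : Nat.Primes) {r : ℕ} (k : Fin r → ℕ+) (φ : ℕ → (ZMod p)[X])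
    (hφ : ∀ s, φ (s + p) = X ^ (p : ℕ) * φ s) :
    ∑ l ∈ Fintype.piFinset (fun _ : Fin r => Finset.Ioo 0 (p : ℕ)),
        C (denom k l : ZMod p)⁻¹ * φ (∑ i, l i) =
      ∑ n ∈ Finset.range p, polyCoeff p (List.ofFn k).reverse n * φ n := by
  induction r generalizing φ with
  | zero => simp [denom, polyCoeff, p.2.pos]
  | succ r ih =>
    -- The last factor of the denominator depends only on s mod p, so absorbing it into φ preserves
    -- the shift rule.
    let ψ : ℕ → (ZMod p)[X] := fun s => C ((s : ZMod p)⁻¹ ^ (k (Fin.last r) : ℕ)) * φ s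
    have hψ : ∀ s, ψ (s + p) = X ^ (p : ℕ) * ψ s := by
      intro s
      simp only [ψ, hφ, Nat.cast_add, CharP.cast_eq_zero, add_zero]
      ring
    rw [sum_piFinset_snoc]
    have h1 : ∀ l : Fin r → ℕ, ∑ b ∈ Finset.Ioo 0 (p : ℕ),
        C (denom k (Fin.snoc l b : Fin (r + 1) → ℕ) : ZMod p)⁻¹ *
          φ (∑ i, (Fin.snoc l b : Fin (r + 1) → ℕ) i) =
        C (denom (fun i => k i.castSucc) l : ZMod p)⁻¹ *
          ∑ b ∈ Finset.Ioo 0 (p : ℕ), ψ (∑ i, l i + b) := by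
      intro l
      rw [Finset.mul_sum]
      refine Finset.sum_congr rfl fun b _ => ?_
      rw [denom_snoc, Fin.sum_univ_castSucc]
      simp only [Fin.snoc_castSucc, Fin.snoc_last, ψ]
      rw [Nat.cast_mul, Nat.cast_pow, mul_inv, C_mul, inv_pow, mul_assoc]
    simp only [h1]
    rw [ih (fun i => k i.castSucc) (fun s => ∑ b ∈ Finset.Ioo 0 (p : ℕ), ψ (s + b)),
      sum_mul_sum_Ioo_shift _ _ _ hψ, List.ofFn_succ_last, List.reverse_append,
      List.reverse_singleton, List.singleton_append]
    · refine Finset.sum_congr rfl fun n _ => ?_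
      simp only [ψ, polyCoeff]
      ring
    · intro s
      rw [Finset.mul_sum]
      refine Finset.sum_congr rfl fun b _ => ?_
      rw [← hψ]
      congr 1
      ring

theorem liSum_eq_polyFamily (p : Nat.Primes) {r : ℕ} (k : Fin r → ℕ+) :
    liSum p k = polyFamily (List.ofFn k).reverse p := by
  rw [liSum_eq_sum_piFinset, polyFamily]
  exact sum_inv_denom_mul p k (fun s => X ^ s) fun s => by ring

theorem polyFamily_nil : polyFamily [] = 1 := by
  funext p
  simp [polyFamily, polyCoeff, p.2.pos]

/-! ### The coefficients as sums -/

/-- The factor 1/n is kept apart because it is exactly the weight built into `sumBelow`, `sumAbove`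
and `sumAll`; the next summation then stays in `sumSpace`. -/
theorem polyCoeff_cons_eq (a : ℕ+) (k : List ℕ+) :
    ∃ g ∈ sumSpace, ∀ p : Nat.Primes, ∀ n < (p : ℕ),
      polyCoeff p (a :: k) n = C ((n : ZMod p)⁻¹) * g n p := by
  obtain ⟨b, rfl⟩ : ∃ b : ℕ, b.succPNat = a := ⟨_, PNat.succPNat_natPred a⟩
  induction k generalizing b with
  | nil =>
    refine ⟨_, basicSeq_mem b [], fun p n hn => ?_⟩
    rcases n.eq_zero_or_pos with rfl | hn0
    · simp [polyCoeff]
    · have h1 : ∑ m ∈ Finset.Ioo n (p : ℕ), (if m = 0 then 1 else 0 : (ZMod p)[X]) = 0 :=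
        Finset.sum_eq_zero fun m hm => if_neg (by rw [Finset.mem_Ioo] at hm; omega)
      simp only [polyCoeff, basicSeq, zetaList, h1]
      simp [hn0, pow_succ']
  | cons c k ih =>
    obtain ⟨g, hg, h⟩ := ih c.natPred
    rw [PNat.succPNat_natPred] at h
    refine ⟨basicSeq b [] * (sumBelow g + (fun _ => powFamily) * sumAbove g),
      sumSpace_mul (basicSeq_mem _ _) (add_mem (sumBelow_mem hg)
        (sumSpace_mul (const_mem_sumSpace powFamily_mem) (sumAbove_mem hg))), fun p n hn => ?_⟩
    rw [polyCoeff]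
    simp only [Pi.mul_apply, Pi.add_apply]
    rw [sumBelow_apply, sumAbove_apply _ hn]
    rw [Finset.sum_congr rfl fun m hm => h p m ((Finset.mem_range.mp hm).trans hn),
      Finset.sum_congr rfl fun m hm => h p m (Finset.mem_Ioo.mp hm).2]
    simp only [basicSeq, zetaList, powFamily, mul_one, Nat.succPNat_coe, Nat.succ_eq_add_one,
      pow_succ', C_mul]
    ring

/-- The defect `T^p ∑ f(m)` of the integration of a finite multiple polylogarithm. -/
def defect (k : List ℕ+) : PolyFamily :=
  fun p => X ^ (p : ℕ) * ∑ m ∈ Finset.Ioo 0 (p : ℕ), polyCoeff p k m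

theorem defect_mem (k : List ℕ+) : defect k ∈ coeffRing := by
  cases k with
  | nil =>
    have h : defect [] = 0 := by
      funext p
      simp only [defect, polyCoeff, Pi.zero_apply]
      rw [Finset.sum_eq_zero, mul_zero]
      intro m hm
      rw [Finset.mem_Ioo] at hm
      rw [if_neg (by omega)]
    rw [h]
    exact zero_mem _
  | cons a k =>
    obtain ⟨g, hg, h⟩ := polyCoeff_cons_eq a k
    have h1 : defect (a :: k) = powFamily * sumAll g := by
      funext p
      rw [Pi.mul_apply, sumAll_apply, sum_range_eq_add_Ioo _ p.2.pos, defect, powFamily]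
      simp only [Finset.sum_range_zero, Nat.cast_zero, inv_zero, C_0, zero_mul, zero_add]
      rw [Finset.sum_congr rfl fun m hm => h p m (Finset.mem_Ioo.mp hm).2]
    rw [h1]
    exact mul_mem powFamily_mem (sumAll_mem hg)

theorem sum_polyCoeff_mul_reflection_mem (a b : ℕ+) (k l : List ℕ+) :
    (fun p => X ^ (p : ℕ) * ∑ m ∈ Finset.range p,
      polyCoeff p (a :: k) m * polyCoeff p (b :: l) (p - m) : PolyFamily) ∈ coeffRing := by
  obtain ⟨f, hf, h⟩ := polyCoeff_cons_eq a k
  obtain ⟨g, hg, h'⟩ := polyCoeff_cons_eq b l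
  obtain ⟨g', hg', hr⟩ := exists_reflection hg
  -- Of the factors 1/m and 1/(p - m) = -1/m, the first is the weight of `sumAll`; the second gives
  -- the sign and `basicSeq 1 []`.
  have h1 : (fun p => X ^ (p : ℕ) * ∑ m ∈ Finset.range p,
      polyCoeff p (a :: k) m * polyCoeff p (b :: l) (p - m) : PolyFamily) =
      powFamily * sumAll (-(f * (basicSeq 1 [] * g'))) := by
    funext p
    rw [Pi.mul_apply, sumAll_apply, powFamily]
    congr 1
    refine Finset.sum_congr rfl fun m hm => ?_
    rw [Finset.mem_range] at hm
    rcases m.eq_zero_or_pos with rfl | hm0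
    · simp [polyCoeff_cons_zero]
    · rw [h p m hm, h' p (p - m) (by omega), ← hr p m hm, cast_sub_prime hm.le, inv_neg]
      simp only [Pi.neg_apply, Pi.mul_apply, basicSeq, zetaList, pow_one, mul_one, C_neg]
      ring
  rw [h1]
  exact mul_mem powFamily_mem
    (sumAll_mem (neg_mem (sumSpace_mul hf (sumSpace_mul (basicSeq_mem _ _) hg'))))

/-! ### Euler derivation and projection to the powers of `T^p` -/

/-- The derivation `T d/dT` in every component. -/
def euler (f : PolyFamily) : PolyFamily := fun p => X * derivative (f p)

/-- The projection to the polynomials in `T^p` in every component. -/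
def proj (f : PolyFamily) : PolyFamily := fun p => expand (ZMod p) p (contract p (f p))

theorem euler_add (f g : PolyFamily) : euler (f + g) = euler f + euler g := by
  funext p; simp [euler, mul_add]

theorem euler_sub (f g : PolyFamily) : euler (f - g) = euler f - euler g := by
  funext p; simp [euler, mul_sub]

theorem euler_mul (f g : PolyFamily) : euler (f * g) = euler f * g + f * euler g := by
  funext p; simp only [euler, Pi.mul_apply, Pi.add_apply, derivative_mul]; ring

theorem proj_add (f g : PolyFamily) : proj (f + g) = proj f + proj g := by
  funext p; simp [proj, contract_add p.2.ne_zero]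

/-- All generators are polynomials in T^p, so the coefficients behave as constants for both `euler`
and `proj`. -/
theorem mem_range_expand_of_mem_coeffRing {z : PolyFamily} (hz : z ∈ coeffRing)
    (p : Nat.Primes) : z p ∈ (expand (ZMod p) p).range := by
  let S : Subring PolyFamily :=
    (expand (ZMod p) p).range.toSubring.comap (Pi.evalRingHom (fun p : Nat.Primes => (ZMod p)[X]) p)
  suffices h : coeffRing ≤ S from h hz
  rw [coeffRing, Subring.closure_le]
  rintro _ (rfl | ⟨k, rfl⟩)
  · exact ⟨X, by simp [powFamily]⟩
  · exact ⟨C (zetaList p k (p - 1)), by simp [zetaFamily]⟩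

theorem derivative_eq_zero_of_mem_range_expand {p : Nat.Primes} {f : (ZMod p)[X]}
    (hf : f ∈ (expand (ZMod p) p).range) : derivative f = 0 := by
  obtain ⟨g, rfl⟩ := hf
  change derivative (expand (ZMod p) p g) = 0
  rw [derivative_expand]
  simp

theorem expand_contract_of_mem_range {p : Nat.Primes} {f : (ZMod p)[X]}
    (hf : f ∈ (expand (ZMod p) p).range) : expand (ZMod p) p (contract p f) = f := by
  obtain ⟨g, rfl⟩ := hf
  change expand (ZMod p) p (contract p (expand (ZMod p) p g)) = expand (ZMod p) p g
  rw [contract_expand p p.2.ne_zero]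

theorem expand_contract_mul_of_mem_range {p : Nat.Primes} {f : (ZMod p)[X]}
    (hf : f ∈ (expand (ZMod p) p).range) (g : (ZMod p)[X]) :
    expand (ZMod p) p (contract p (f * g)) = f * expand (ZMod p) p (contract p g) := by
  obtain ⟨f, rfl⟩ := hf
  change expand (ZMod p) p (contract p (expand (ZMod p) p f * g)) = expand (ZMod p) p f * _
  rw [mul_comm, contract_mul_expand p.2.ne_zero, map_mul, mul_comm]

theorem euler_of_mem {z : PolyFamily} (hz : z ∈ coeffRing) : euler z = 0 := by
  funext p
  simp [euler, derivative_eq_zero_of_mem_range_expand (mem_range_expand_of_mem_coeffRing hz p)]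

theorem euler_coeff_mul {z : PolyFamily} (hz : z ∈ coeffRing) (f : PolyFamily) :
    euler (z * f) = z * euler f := by
  rw [euler_mul, euler_of_mem hz, zero_mul, zero_add]

theorem proj_of_mem {z : PolyFamily} (hz : z ∈ coeffRing) : proj z = z := by
  funext p
  exact expand_contract_of_mem_range (mem_range_expand_of_mem_coeffRing hz p)

theorem proj_coeff_mul {z : PolyFamily} (hz : z ∈ coeffRing) (f : PolyFamily) :
    proj (z * f) = z * proj f := by
  funext p
  exact expand_contract_mul_of_mem_range (mem_range_expand_of_mem_coeffRing hz p) (f p)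

/-- T d/dT multiplies T^n by n, which is zero in `𝔽_p` for the exponents n that `proj` retains. -/
theorem proj_euler (f : PolyFamily) : proj (euler f) = 0 := by
  funext p
  have h : contract p (X * derivative (f p)) = 0 := by
    ext n
    rw [coeff_contract p.2.ne_zero, coeff_zero]
    cases h : n * (p : ℕ) with
    | zero => simp
    | succ m =>
      have h0 : ((m : ZMod p) + 1) = 0 := by
        rw [← Nat.cast_succ, ← Nat.add_one, ← h]; simp
      rw [coeff_X_mul, coeff_derivative, h0, mul_zero]
  simp [proj, euler, h]

theorem proj_eq_self_of_euler {f : PolyFamily} (h : euler f = 0) : proj f = f := by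
  funext p
  have h1 : X * derivative (f p) = 0 := congrFun h p
  have h2 : derivative (f p) = 0 := (mul_eq_zero.mp h1).resolve_left X_ne_zero
  exact expand_contract p h2 p.2.ne_zero

theorem polyCoeff_mem_range_expand (p : Nat.Primes) (k : List ℕ+) (n : ℕ) :
    polyCoeff p k n ∈ (expand (ZMod p) p).range := by
  induction k generalizing n with
  | nil =>
    rw [polyCoeff]
    split_ifs
    · exact one_mem _
    · exact zero_mem _
  | cons a k ih =>
    rw [polyCoeff]
    refine mul_mem ⟨C _, expand_C _ _⟩ (add_mem (sum_mem fun m _ => ih m)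
      (mul_mem ⟨X, expand_X _⟩ (sum_mem fun m _ => ih m)))

theorem euler_polyFamily (k : List ℕ+) (p : Nat.Primes) :
    euler (polyFamily k) p =
      ∑ n ∈ Finset.range p, C (n : ZMod p) * polyCoeff p k n * X ^ n := by
  rw [euler, polyFamily, derivative_sum, Finset.mul_sum]
  refine Finset.sum_congr rfl fun n _ => ?_
  rw [derivative_mul, derivative_eq_zero_of_mem_range_expand (polyCoeff_mem_range_expand p k n),
    zero_mul, zero_add, derivative_X_pow]
  cases n with
  | zero => simp
  | succ n => rw [Nat.add_sub_cancel, pow_succ]; ring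

theorem natCast_ne_zero_of_lt {p : Nat.Primes} {n : ℕ} (h0 : n ≠ 0) (h : n < p) :
    (n : ZMod p) ≠ 0 := by
  rw [Ne, ZMod.natCast_eq_zero_iff]
  exact Nat.not_dvd_of_pos_of_lt (Nat.pos_of_ne_zero h0) h

/-- The operator T d/dT multiplies the coefficient of T^n by n, cancelling one factor n⁻¹ for 0 < n
< p; the coefficient at n = 0 vanishes. -/
theorem euler_polyFamily_succ (a : ℕ+) (k : List ℕ+) :
    euler (polyFamily ((a + 1) :: k)) = polyFamily (a :: k) := by
  funext p
  rw [euler_polyFamily, polyFamily]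
  refine Finset.sum_congr rfl fun n hn => ?_
  rw [Finset.mem_range] at hn
  congr 1
  rcases eq_or_ne n 0 with rfl | h0
  · simp [polyCoeff_cons_zero]
  · rw [polyCoeff, polyCoeff, ← mul_assoc, ← C_mul, PNat.add_coe, PNat.one_coe, pow_succ',
      mul_inv_cancel_left₀ (natCast_ne_zero_of_lt h0 hn)]

/-- The family of the polynomials `T + T² + ⋯ + T^(p-1)`. -/
def geomFamily : PolyFamily := fun p => ∑ b ∈ Finset.Ioo 0 (p : ℕ), X ^ b

/-- For 0 < n < p, the coefficient of T^n on the left is n times that of the polylogarithm with an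
exponent 1 added. At n = 0 that product vanishes, and the wrapped-around sum remains as the defect.
-/
theorem geomFamily_mul_polyFamily (k : List ℕ+) :
    geomFamily * polyFamily k = euler (polyFamily (1 :: k)) + defect k := by
  funext p
  have h := sum_mul_sum_Ioo_shift p (polyCoeff p k) (fun n => X ^ n) fun s => by ring
  have h1 : (geomFamily * polyFamily k) p =
      ∑ m ∈ Finset.range p, polyCoeff p k m * ∑ b ∈ Finset.Ioo 0 (p : ℕ), X ^ (m + b) := by
    rw [Pi.mul_apply, polyFamily, geomFamily, mul_comm, Finset.sum_mul]
    refine Finset.sum_congr rfl fun m _ => ?_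
    simp only [pow_add, ← Finset.mul_sum, mul_assoc]
  rw [h1, h, Pi.add_apply, euler_polyFamily, sum_range_eq_add_Ioo _ p.2.pos,
    sum_range_eq_add_Ioo _ p.2.pos, defect]
  simp only [Finset.sum_range_zero, zero_add, pow_zero, one_mul, Nat.cast_zero, C_0, zero_mul]
  rw [add_comm]
  congr 1
  refine Finset.sum_congr rfl fun n hn => ?_
  rw [Finset.mem_Ioo] at hn
  rw [polyCoeff, ← mul_assoc, ← C_mul, PNat.one_coe, pow_one,
    mul_inv_cancel₀ (natCast_ne_zero_of_lt hn.1.ne' hn.2), C_1, one_mul, mul_comm]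

theorem expand_contract_X_pow (p : Nat.Primes) (n : ℕ) :
    expand (ZMod p) p (contract p (X ^ n)) = if (p : ℕ) ∣ n then X ^ n else 0 := by
  split_ifs with h
  · obtain ⟨m, rfl⟩ := h
    exact expand_contract_of_mem_range ⟨X ^ m, by simp [pow_mul]⟩
  · have h1 : contract p (X ^ n : (ZMod p)[X]) = 0 := by
      ext m
      rw [coeff_contract p.2.ne_zero, coeff_X_pow, coeff_zero, if_neg]
      rintro rfl
      exact h (Dvd.intro_left m rfl)
    rw [h1, map_zero]

theorem proj_sum (p : Nat.Primes) (s : Finset ℕ) (f : ℕ → (ZMod p)[X]) :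
    expand (ZMod p) p (contract p (∑ n ∈ s, f n)) =
      ∑ n ∈ s, expand (ZMod p) p (contract p (f n)) := by
  induction s using Finset.cons_induction with
  | empty => simp [contract]
  | cons a s ha ih => rw [Finset.sum_cons, Finset.sum_cons, contract_add p.2.ne_zero, map_add, ih]

theorem proj_polyFamily_cons (a : ℕ+) (k : List ℕ+) : proj (polyFamily (a :: k)) = 0 := by
  rw [← euler_polyFamily_succ, proj_euler]

/-- The coefficients pass through `proj`, and the coefficients at 0 vanish, so only pairs of
exponents with sum p survive. -/
theorem proj_polyFamily_mul_mem (a b : ℕ+) (k l : List ℕ+) :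
    proj (polyFamily (a :: k) * polyFamily (b :: l)) ∈ coeffRing := by
  have h : proj (polyFamily (a :: k) * polyFamily (b :: l)) =
      fun p : Nat.Primes => X ^ (p : ℕ) * ∑ m ∈ Finset.range p,
        polyCoeff p (a :: k) m * polyCoeff p (b :: l) (p - m) := by
    funext p
    rw [proj, Pi.mul_apply, polyFamily, polyFamily, Finset.sum_mul_sum, proj_sum, Finset.mul_sum]
    refine Finset.sum_congr rfl fun m hm => ?_
    rw [Finset.mem_range] at hm
    rw [proj_sum]
    have h1 : ∀ n, expand (ZMod p) p (contract p
        (polyCoeff p (a :: k) m * X ^ m * (polyCoeff p (b :: l) n * X ^ n))) =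
        polyCoeff p (a :: k) m * polyCoeff p (b :: l) n *
          if (p : ℕ) ∣ m + n then X ^ (m + n) else 0 := by
      intro n
      rw [mul_mul_mul_comm, ← pow_add, expand_contract_mul_of_mem_range
        (mul_mem (polyCoeff_mem_range_expand p _ _) (polyCoeff_mem_range_expand p _ _)),
        expand_contract_X_pow]
    simp only [h1]
    rcases m.eq_zero_or_pos with rfl | hm0
    · simp [polyCoeff_cons_zero]
    · rw [Finset.sum_eq_single_of_mem (p - m : ℕ) (Finset.mem_range.mpr (by omega))]
      · rw [Nat.add_sub_cancel' hm.le, if_pos dvd_rfl]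
        ring
      · intro n hn hne
        rw [Finset.mem_range] at hn
        rcases n.eq_zero_or_pos with rfl | hn0
        · simp [polyCoeff_cons_zero]
        · rw [if_neg, mul_zero]
          rintro ⟨c, hc⟩
          -- As 0 < m + n < 2p, a multiple of p can only be p itself, which contradicts n ≠ p - m.
          rcases c with _ | _ | c
          · omega
          · omega
          · have : (p : ℕ) * (c + 1 + 1) = p * c + p + p := by ring
            have := Nat.zero_le ((p : ℕ) * c)
            omega
  rw [h]
  exact sum_polyCoeff_mul_reflection_mem a b k l

/-! ### Closure under multiplication -/

/-- The span of the finite multiple polylogarithms over `coeffRing`. -/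
def polySpan : Submodule coeffRing PolyFamily :=
  Submodule.span coeffRing (Set.range polyFamily)

theorem polyFamily_mem (k : List ℕ+) : polyFamily k ∈ polySpan :=
  Submodule.subset_span ⟨k, rfl⟩

theorem coeff_mul_mem {z f : PolyFamily} (hz : z ∈ coeffRing) (hf : f ∈ polySpan) :
    z * f ∈ polySpan :=
  polySpan.smul_mem ⟨z, hz⟩ hf

theorem coeff_mem_polySpan {z : PolyFamily} (hz : z ∈ coeffRing) : z ∈ polySpan := by
  have h := coeff_mul_mem hz (polyFamily_mem [])
  rwa [polyFamily_nil, mul_one] at h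

/-- The families which are, up to an element of `coeffRing`, the image of an element of
`polySpan` under `T d/dT`. -/
def integrable : Submodule coeffRing PolyFamily where
  carrier := {f | ∃ g ∈ polySpan, ∃ c ∈ coeffRing, f = euler g + c}
  zero_mem' := ⟨0, zero_mem _, 0, zero_mem _, by rw [euler_of_mem (zero_mem _), add_zero]⟩
  add_mem' := by
    rintro _ _ ⟨g, hg, c, hc, rfl⟩ ⟨g', hg', c', hc', rfl⟩
    exact ⟨g + g', add_mem hg hg', c + c', add_mem hc hc', by
      rw [euler_add, add_add_add_comm]⟩
  smul_mem' := by
    rintro z _ ⟨g, hg, c, hc, rfl⟩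
    refine ⟨z * g, coeff_mul_mem z.2 hg, z * c, mul_mem z.2 hc, ?_⟩
    rw [euler_coeff_mul z.2, ← mul_add]
    rfl

/-- Raising the last exponent integrates a polylogarithm of nonempty index. The constant 1 is not of
the form T dg/dT, which is why `integrable` allows a coefficient. -/
theorem polySpan_le_integrable : polySpan ≤ integrable := by
  rw [polySpan, Submodule.span_le]
  rintro _ ⟨k, rfl⟩
  cases k with
  | nil =>
    exact ⟨0, zero_mem _, 1, one_mem _, by
      rw [euler_of_mem (zero_mem _), zero_add, polyFamily_nil]⟩
  | cons a k =>
    exact ⟨_, polyFamily_mem ((a + 1) :: k), 0, zero_mem _, by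
      rw [euler_polyFamily_succ, add_zero]⟩

theorem geomFamily_mul_mem_integrable {f : PolyFamily} (hf : f ∈ polySpan) :
    geomFamily * f ∈ integrable := by
  induction hf using Submodule.span_induction with
  | mem f hf =>
    obtain ⟨k, rfl⟩ := hf
    exact ⟨_, polyFamily_mem _, _, defect_mem k, geomFamily_mul_polyFamily k⟩
  | zero => rw [mul_zero]; exact zero_mem _
  | add f g _ _ hf hg => rw [mul_add]; exact add_mem hf hg
  | smul z f _ hf => rw [mul_smul_comm]; exact integrable.smul_mem z hf

theorem proj_mem {f : PolyFamily} (hf : f ∈ polySpan) : proj f ∈ coeffRing := by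
  induction hf using Submodule.span_induction with
  | mem f hf =>
    obtain ⟨k, rfl⟩ := hf
    cases k with
    | nil => rw [polyFamily_nil, proj_of_mem (one_mem _)]; exact one_mem _
    | cons a k => rw [proj_polyFamily_cons]; exact zero_mem _
  | zero => rw [proj_of_mem (zero_mem _)]; exact zero_mem _
  | add f g _ _ hf hg => rw [proj_add]; exact add_mem hf hg
  | smul z f _ hf =>
    change proj (z * f) ∈ coeffRing
    rw [proj_coeff_mul z.2]
    exact mul_mem z.2 hf

/-- Applying `proj` to `euler f = euler g + c` forces c = 0. Then f - g is killed by `euler`, so it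
equals its own projection, which is a coefficient. -/
theorem mem_polySpan_of_euler_mem {f : PolyFamily} (hf : proj f ∈ coeffRing)
    (h : euler f ∈ integrable) : f ∈ polySpan := by
  obtain ⟨g, hg, c, hc, h⟩ := h
  have hc0 : c = 0 := by
    have h1 := congrArg proj h
    rwa [proj_add, proj_euler, proj_euler, proj_of_mem hc, zero_add, eq_comm] at h1
  rw [hc0, add_zero] at h
  have h2 : proj (f - g) = f - g :=
    proj_eq_self_of_euler (by rw [euler_sub, h, sub_self])
  have h3 : proj f = proj (f - g) + proj g := by rw [← proj_add, sub_add_cancel]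
  have h4 : f = proj f - proj g + g := by rw [h3, h2]; ring
  rw [h4]
  exact add_mem (coeff_mem_polySpan (sub_mem hf (proj_mem hg))) hg

/-- The weight of an index. -/
def weight (k : List ℕ+) : ℕ := (k.map fun a : ℕ+ => (a : ℕ)).sum

/-- Either the exponent a drops by one or, for a = 1, the entry disappears; in both cases the total
weight decreases and the induction hypothesis on products applies. -/
theorem euler_polyFamily_mul_mem {n : ℕ}
    (ih : ∀ k l, weight k + weight l < n → polyFamily k * polyFamily l ∈ polySpan)
    (a : ℕ+) (k l : List ℕ+) (h : weight (a :: k) + weight l ≤ n) :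
    euler (polyFamily (a :: k)) * polyFamily l ∈ integrable := by
  simp only [weight, List.map_cons, List.sum_cons] at h
  -- This serves only to separate a = 1 from a > 1.
  induction a using PNat.recOn with
  | one =>
    have h1 : euler (polyFamily (1 :: k)) * polyFamily l =
        geomFamily * (polyFamily k * polyFamily l) - defect k * polyFamily l := by
      rw [← mul_assoc, geomFamily_mul_polyFamily]; ring
    rw [h1]
    refine sub_mem (geomFamily_mul_mem_integrable (ih k l ?_))
      (polySpan_le_integrable (coeff_mul_mem (defect_mem k) (polyFamily_mem l)))
    simp only [weight, PNat.one_coe] at h ⊢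
    omega
  | succ a _ =>
    rw [euler_polyFamily_succ]
    refine polySpan_le_integrable (ih _ _ ?_)
    simp only [weight, List.map_cons, List.sum_cons, PNat.add_coe, PNat.one_coe] at h ⊢
    omega

theorem polyFamily_mul_mem (k l : List ℕ+) : polyFamily k * polyFamily l ∈ polySpan := by
  induction h : weight k + weight l using Nat.strong_induction_on generalizing k l with
  | _ n ih =>
    cases k with
    | nil => rw [polyFamily_nil, one_mul]; exact polyFamily_mem l
    | cons a k =>
      cases l with
      | nil => rw [polyFamily_nil, mul_one]; exact polyFamily_mem _
      | cons b l =>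
        have ih' : ∀ k l, weight k + weight l < n → polyFamily k * polyFamily l ∈ polySpan :=
          fun k l hkl => ih _ hkl k l rfl
        refine mem_polySpan_of_euler_mem (proj_polyFamily_mul_mem a b k l) ?_
        rw [euler_mul, mul_comm (polyFamily (a :: k))]
        exact add_mem (euler_polyFamily_mul_mem ih' a k _ h.le)
          (euler_polyFamily_mul_mem ih' b l _ (by rw [add_comm]; exact h.le))

/-! ### Passage to the quotient -/

/-- The index whose reversed sequence of entries is `k`. -/
def indexOfList (k : List ℕ+) : Index := ⟨k.reverse.length, k.reverse.get⟩

theorem reverse_ofFn_indexOfList (k : List ℕ+) : (List.ofFn (indexOfList k).2).reverse = k := by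
  simp only [indexOfList, List.ofFn_get, List.reverse_reverse]

theorem li_eq_toB (k : Index) : li k = toB (polyFamily (List.ofFn k.2).reverse) := by
  rw [li]
  congr 1
  funext p
  exact liSum_eq_polyFamily p k.2

theorem toB_zetaFamily (k : List ℕ+) :
    toB (zetaFamily k) = algebraMap A B (zetaA (indexOfList k)) := by
  rw [zetaA, algebraMap_toA]
  congr 1
  funext p
  rw [zetaFamily]
  congr 1
  have h := zetaSum_eq_zetaList p (indexOfList k).2 (p - 1)
  rwa [Nat.sub_add_cancel p.2.one_le, reverse_ofFn_indexOfList, eq_comm] at h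

/-- Integral combinations suffice here: only the two kinds of generators of `coeffRing` need to be
checked. -/
theorem toB_mem_ZATp {z : PolyFamily} (hz : z ∈ coeffRing) : toB z ∈ ZATp := by
  let S : Subring PolyFamily :=
    ZATp.toSubring.comap (Ideal.Quotient.mk (almostZero fun p => Polynomial (ZMod p)))
  suffices h : coeffRing ≤ S from h hz
  rw [coeffRing, Subring.closure_le]
  rintro _ (rfl | ⟨k, rfl⟩)
  · exact Algebra.subset_adjoin (Set.mem_singleton Tp)
  · change toB (zetaFamily k) ∈ ZATp
    rw [toB_zetaFamily]
    exact ZATp.algebraMap_mem ⟨zetaA (indexOfList k), Submodule.subset_span ⟨_, rfl⟩⟩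

theorem toB_mem_R {f : PolyFamily} (hf : f ∈ polySpan) : toB f ∈ R := by
  induction hf using Submodule.span_induction with
  | mem f hf =>
    obtain ⟨k, rfl⟩ := hf
    rw [← reverse_ofFn_indexOfList k, ← li_eq_toB]
    exact Submodule.subset_span ⟨_, rfl⟩
  | zero => exact zero_mem R
  | add f g _ _ hf hg => exact add_mem (S := Submodule ZATp B) hf hg
  | smul z f _ hf => exact R.smul_mem ⟨toB z, toB_mem_ZATp z.2⟩ hf

theorem li_mul_li_mem (k l : Index) : li k * li l ∈ R := by
  rw [li_eq_toB, li_eq_toB]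
  exact toB_mem_R (polyFamily_mul_mem _ _)

theorem one_mem_R : (1 : B) ∈ R :=
  toB_mem_R (coeff_mem_polySpan (one_mem _))

theorem mul_mem_R {f g : B} (hf : f ∈ R) (hg : g ∈ R) : f * g ∈ R := by
  induction hf using Submodule.span_induction with
  | mem f hf =>
    obtain ⟨k, rfl⟩ := hf
    induction hg using Submodule.span_induction with
    | mem g hg =>
      obtain ⟨l, rfl⟩ := hg
      exact li_mul_li_mem k l
    | zero => rw [mul_zero]; exact zero_mem R
    | add g g' _ _ hg hg' => rw [mul_add]; exact add_mem (S := Submodule ZATp B) hg hg'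
    | smul z g _ hg =>
      have h : li k * z • g = z • (li k * g) := mul_left_comm _ _ _
      rw [h]
      exact R.smul_mem z hg
  | zero => rw [zero_mul]; exact zero_mem R
  | add f f' _ _ hf hf' => rw [add_mul]; exact add_mem (S := Submodule ZATp B) hf hf'
  | smul z f _ hf =>
    have h : z • f * g = z • (f * g) := mul_assoc _ _ _
    rw [h]
    exact R.smul_mem z hf

end FinitePolylog

end

theorem mainTheorem4 :
    (∀ f ∈ FinitePolylog.R, ∀ g ∈ FinitePolylog.R, f * g ∈ FinitePolylog.R) ∧
      ∃ S : Subalgebra FinitePolylog.ZATp FinitePolylog.B,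
        Subalgebra.toSubmodule S = FinitePolylog.R :=
  ⟨fun _ hf _ hg => FinitePolylog.mul_mem_R hf hg,
    { carrier := FinitePolylog.R
      mul_mem' := FinitePolylog.mul_mem_R
      one_mem' := FinitePolylog.one_mem_R
      add_mem' := FinitePolylog.R.add_mem
      zero_mem' := FinitePolylog.R.zero_mem
      algebraMap_mem' := fun r => by
        have h := FinitePolylog.R.smul_mem r FinitePolylog.one_mem_R
        have h' : r • (1 : FinitePolylog.B) = r.1 := mul_one r.1
        rw [h'] at h
        exact h },
    rfl⟩
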